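/- For a ring $R$ let $S(R)=\{a^2 : a\in R\}$ be its set of squares, for $A\subseteq R$ let $A+A=\{a+b : a,b\in A\}$, and for $n\in\mathbb{N}$ let $$N_n(R)=\inf\{\,|A+A| : A\subseteq S(R),\ |A|=n\,\}$$ (the infimum of the empty set being $\infty$). Write $\mathbb{Z}_p=\mathbb{Z}/p\mathbb{Z}$. **Theorem.** Let $p$ be a prime. Then $$N_6(\mathbb{Z}_p)=\begin{cases} 11 & \text{for } p=11,53,61,67,71,73,79,83,89,97,101,103,107,109,127,131,137 \text{ and all } p\ge 149,\\ 12 & \text{for } p=17,23,41,43,47,113,139,\\ 13 & \text{for } p=13,19,31,37,59,\\ 14 & \text{for } p=29. \end{cases}$$ -/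

import Mathlib

open scoped Pointwise

/-- The set `S(R)` of squares in a ring `R`. -/
def squares (R : Type*) [Ring R] : Set R :=
  {x | ∃ a : R, x = a ^ 2}

/-- `N_n(R)`: the infimum of `|A + A|` over all `n`-element subsets `A` of `S(R)`.
It takes values in `ℕ∞`, so that the infimum over the empty family is `⊤`. -/
noncomputable def minSumset (n : ℕ) (R : Type*) [Ring R] [DecidableEq R] : ℕ∞ :=
  ⨅ (A : Finset R) (_ : (A : Set R) ⊆ squares R) (_ : A.card = n), ((A + A).card : ℕ∞)

/-! For `p ≥ 11`, Cauchy–Davenport gives `|A + A| ≥ 11`, and a six-term progression of squares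
attains 11. Multiplying by a nonsquare turns a progression of nonsquares into one of squares, so six
terms in progression with one quadratic character suffice (zero fits either class). The character is
multiplicative, so its values at `-1` and a few small primes fix it on many integers; a finite case
tree over these values always ends in such a progression of integers. The differences are less than
149, hence nonzero modulo every `p ≥ 149`.

The smaller primes need explicit witnesses and, for values above 11, a lower bound by search. If
`|A| = 6` and `|A + A| ≤ 13`, additive energy forces a nonzero difference `d` with at least three
representations. Dividing by `d` preserves `|A + A|` and leaves a set of squares, or of nonsquares
and zero, with three pairs `x, x + 1`. This normalisation makes a pruned search over residues short
enough for the kernel. -/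

/-! ### Bounds for `minSumset` -/

theorem minSumset_le {R : Type*} [Ring R] [DecidableEq R] {A : Finset R} {n k : ℕ}
    (hA : (A : Set R) ⊆ squares R) (hn : A.card = n) (hk : (A + A).card ≤ k) :
    minSumset n R ≤ k :=
  (iInf_le_of_le A <| iInf_le_of_le hA <| iInf_le_of_le hn le_rfl).trans (by exact_mod_cast hk)

theorem le_minSumset {R : Type*} [Ring R] [DecidableEq R] {n k : ℕ}
    (h : ∀ A : Finset R, (A : Set R) ⊆ squares R → A.card = n → k ≤ (A + A).card) :
    (k : ℕ∞) ≤ minSumset n R :=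
  le_iInf fun A => le_iInf fun hA => le_iInf fun hn => by exact_mod_cast h A hA hn

theorem minSumset_le_of_roots {R : Type*} [Ring R] [DecidableEq R] (B : Finset R) {n k : ℕ}
    (h : (B.image (· ^ 2)).card = n ∧ (B.image (· ^ 2) + B.image (· ^ 2)).card ≤ k) :
    minSumset n R ≤ k := by
  refine minSumset_le ?_ h.1 h.2
  intro x hx
  obtain ⟨b, -, rfl⟩ := Finset.mem_image.1 (Finset.mem_coe.1 hx)
  exact ⟨b, rfl⟩

theorem eleven_le_minSumset_six {p : ℕ} (hp : p.Prime) (h : 11 ≤ p) :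
    11 ≤ minSumset 6 (ZMod p) := by
  refine le_minSumset (k := 11) fun A _ hA => ?_
  have hne : A.Nonempty := Finset.card_pos.1 (by omega)
  have := ZMod.cauchy_davenport hp hne hne
  rw [hA] at this
  exact (le_min h (by norm_num)).trans this

/-- Six squares in arithmetic progression modulo a large prime. -/
theorem minSumset_six_le_of_progression {p : ℕ} [Fact p.Prime] (hp : 6 ≤ p) {a d : ZMod p}
    (hd : d ≠ 0) (h : ∀ i < 6, IsSquare (a + (i : ℕ) * d)) : minSumset 6 (ZMod p) ≤ 11 := by
  refine minSumset_le (A := (Finset.range 6).image fun i : ℕ => a + i * d) (k := 11) ?_ ?_ ?_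
  · intro x hx
    obtain ⟨i, hi, rfl⟩ := Finset.mem_image.1 (Finset.mem_coe.1 hx)
    obtain ⟨r, hr⟩ := h i (Finset.mem_range.1 hi)
    exact ⟨r, by rw [hr, sq]⟩
  · rw [Finset.card_image_of_injOn, Finset.card_range]
    intro i hi j hj hij
    have hi' : i < 6 := by simpa using hi
    have hj' : j < 6 := by simpa using hj
    have h1 : (i : ZMod p) = j := mul_right_cancel₀ hd (add_left_cancel hij)
    have h2 := (ZMod.natCast_eq_natCast_iff' i j p).1 h1
    rwa [Nat.mod_eq_of_lt (by omega), Nat.mod_eq_of_lt (by omega)] at h2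
  · have hsub : ((Finset.range 6).image fun i : ℕ => a + i * d) +
        ((Finset.range 6).image fun i : ℕ => a + i * d) ⊆
        (Finset.range 11).image fun i : ℕ => 2 * a + i * d := by
      intro x hx
      obtain ⟨y, hy, z, hz, rfl⟩ := Finset.mem_add.1 hx
      obtain ⟨i, hi, rfl⟩ := Finset.mem_image.1 hy
      obtain ⟨j, hj, rfl⟩ := Finset.mem_image.1 hz
      rw [Finset.mem_range] at hi hj
      exact Finset.mem_image.2 ⟨i + j, Finset.mem_range.2 (by omega), by push_cast; ring⟩
    exact (Finset.card_le_card hsub).trans (Finset.card_image_le.trans (by simp))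

/-! ### A difference represented three times -/

/-- Cauchy–Schwarz gives `|A|^4 ≤ |A + A| E(A)`. If every nonzero difference had at most two
representations, then `E(A) ≤ 6·6 + 30·2 = 96`, but `13·96 = 1248 < 1296 = 6^4`. -/
theorem exists_three_le_card_filter_add_mem {G : Type*} [AddCommGroup G] [DecidableEq G]
    {A : Finset G} (hA : A.card = 6) (hAA : (A + A).card ≤ 13) :
    ∃ d ≠ 0, 3 ≤ (A.filter fun x => x + d ∈ A).card := by
  by_contra! hcon
  have hE := Finset.le_card_add_mul_addEnergy A A
  have hub : A.addEnergy A ≤ 96 := by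
    have hfib (q : G × G) (hq : q ∈ A ×ˢ A) :
        ((A ×ˢ A).filter fun r => q.1 + r.1 = q.2 + r.2).card ≤ if q.1 = q.2 then 6 else 2 := by
      -- For fixed `q`, the pair `r` is determined by `r.2`, as `r.1 = r.2 + (q.2 - q.1)`.
      have hle : ((A ×ˢ A).filter fun r => q.1 + r.1 = q.2 + r.2).card ≤
          (A.filter fun x => x + (q.2 - q.1) ∈ A).card := by
        refine Finset.card_le_card_of_injOn Prod.snd ?_ ?_
        · intro r hr
          simp only [Finset.coe_filter, Finset.mem_product, Set.mem_ofPred_eq] at hr ⊢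
          refine ⟨hr.1.2, ?_⟩
          have : r.2 + (q.2 - q.1) = r.1 := by rw [← add_sub_assoc, add_comm r.2, ← hr.2]; abel
          rw [this]; exact hr.1.1
        · intro r hr s hs hrs
          simp only [Finset.coe_filter, Finset.mem_product, Set.mem_ofPred_eq] at hr hs
          refine Prod.ext (add_left_cancel (a := q.1) ?_) hrs
          rw [hr.2, hs.2, hrs]
      refine hle.trans ?_
      split_ifs with h
      · exact (Finset.card_filter_le _ _).trans hA.le
      · exact Nat.le_of_lt_succ (hcon _ (sub_ne_zero.2 (Ne.symm h)))
    have hsum : A.addEnergy A =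
        ∑ q ∈ A ×ˢ A, ((A ×ˢ A).filter fun r => q.1 + r.1 = q.2 + r.2).card := by
      rw [Finset.addEnergy, Finset.card_filter, Finset.sum_product]
      simp_rw [Finset.card_filter]
    rw [hsum]
    refine (Finset.sum_le_sum hfib).trans ?_
    have hsplit : ∀ x ∈ A, ∑ y ∈ A, (if x = y then 6 else 2) = 16 := by
      intro x hx
      have : ∀ y ∈ A, (if x = y then 6 else 2) = 2 + if x = y then 4 else 0 := by
        intro y _; split_ifs <;> rfl
      rw [Finset.sum_congr rfl this, Finset.sum_add_distrib, Finset.sum_ite_eq]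
      simp [hx, hA]
    rw [Finset.sum_product, Finset.sum_congr rfl hsplit]
    simp [hA]
  rw [hA] at hE
  nlinarith

/-! ### Exhaustive search for small sumsets

Subsets of `ZMod p` and their sumsets are lists of residues. The continuation-passing
definitions make the kernel evaluate arguments before it substitutes them. -/

/-- Evaluates `n`, then calls `k`. -/
def forceNat (n : ℕ) (k : ℕ → Bool) : Bool :=
  match n with
  | 0 => k 0
  | m + 1 => k (Nat.succ m)

/-- Evaluates a list, then calls `k`. -/
def forceList : List ℕ → (List ℕ → Bool) → Bool
  | [], k => k []
  | x :: l, k => forceNat x fun x => forceList l fun l => k (x :: l)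

/-- Membership in a list of natural numbers. -/
noncomputable def memNat (s : ℕ) (T : List ℕ) : Bool :=
  List.rec false (fun t _ ih => bif Nat.beq s t then true else ih) T

/-- Adds the sums `w + u` for `u` in the first list to the set `T` of residues; succeeds at once
when more than `r` new elements appear. -/
noncomputable def addSums (p w : ℕ) :
    List ℕ → List ℕ → (r : ℕ) → (List ℕ → ℕ → Bool) → Bool
  | [], T, r, k => k T r
  | u :: U, T, r, k => forceNat (Nat.mod (Nat.add w u) p) fun s =>
    bif memNat s T then addSums p w U T r k
    else match r with
      | 0 => true
      | r + 1 => addSums p w U (s :: T) r k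

/-- Adjoins `w` to the set `U` with sumset `T`. -/
noncomputable def adjoin (p w : ℕ) (U T : List ℕ) (r : ℕ)
    (k : List ℕ → List ℕ → ℕ → Bool) : Bool :=
  bif memNat w U then k U T r else addSums p w (w :: U) T r (k (w :: U))

/-- Every way to adjoin `fuel` elements of `L` to `U` gives more than `r` new sums. -/
noncomputable def extendSearch (p : ℕ) (L : List ℕ) :
    (fuel : ℕ) → List ℕ → List ℕ → (r : ℕ) → Bool
  -- A complete set that stayed within the budget is a counterexample.
  | 0, _, _, _ => false
  | k + 1, U, T, r => L.all fun w => memNat w U || adjoin p w U T r (extendSearch p L k)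

/-- Every six-element extension by `n` pairs `x, x + 1` with `x` in the given list and by elements
of `L` has more than `r` new sums. -/
noncomputable def pairSearch (p : ℕ) (L : List ℕ) :
    (n : ℕ) → List ℕ → List ℕ → List ℕ → (r : ℕ) → Bool
  -- Pairs may share elements, so the number still missing is read off from `U`.
  | 0, _, U, T, r => extendSearch p L (6 - U.length) U T r
  | _ + 1, [], _, _, _ => true
  | n + 1, x :: P, U, T, r =>
    (adjoin p x U T r fun U T r => forceNat (Nat.mod (Nat.succ x) p) fun y =>
      adjoin p y U T r (pairSearch p L n P)) && pairSearch p L (n + 1) P U T r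

/-- The residue `w` is a square modulo `p`. -/
def isSquareMod (p w : ℕ) : Bool :=
  (List.range p).any fun i => Nat.beq (i * i % p) w

/-- No six-element set consisting of squares, or of zero and nonsquares, with three pairs
`x, x + 1` has at most `M` sums modulo `p`. -/
noncomputable def noSmallSumset (p M : ℕ) : Bool :=
  [true, false].all fun c =>
    forceList ((List.range p).filter fun w => Nat.beq w 0 || (isSquareMod p w == c)) fun L =>
      forceList (L.filter fun w => memNat ((w + 1) % p) L) fun P =>
        pairSearch p L 3 P [] [] M

/-! ### Soundness of the search -/

theorem forceNat_eq (n : ℕ) (k : ℕ → Bool) : forceNat n k = k n := by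
  cases n <;> rfl

theorem forceList_eq (l : List ℕ) (k : List ℕ → Bool) : forceList l k = k l := by
  induction l generalizing k with
  | nil => rfl
  | cons x l ih => rw [forceList, forceNat_eq, ih]

theorem memNat_eq_true {s : ℕ} : ∀ {T : List ℕ}, memNat s T = true ↔ s ∈ T
  | [] => by simp [memNat]
  | t :: T => by
    change (bif Nat.beq s t then true else memNat s T) = true ↔ _
    rw [Bool.cond_true_left, Bool.or_eq_true, Nat.beq_eq, memNat_eq_true, List.mem_cons]

/-- `U` lists distinct elements of `S`, as residues. -/
structure ListsResidues {p : ℕ} (S : Finset (ZMod p)) (U : List ℕ) : Prop where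
  mem : ∀ u ∈ U, u < p ∧ (u : ZMod p) ∈ S
  nodup : U.Nodup

namespace ListsResidues

variable {p : ℕ} {S : Finset (ZMod p)} {U : List ℕ}

theorem cons {w : ℕ} (h : ListsResidues S U) (hwp : w < p) (hw : (w : ZMod p) ∈ S)
    (hwU : w ∉ U) : ListsResidues S (w :: U) :=
  ⟨by simpa [hwp, hw] using h.mem, List.nodup_cons.2 ⟨hwU, h.nodup⟩⟩

theorem length_le (h : ListsResidues S U) : U.length ≤ S.card := by
  have hinj : Set.InjOn (fun u : ℕ => (u : ZMod p)) (U.toFinset : Set ℕ) := by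
    intro u hu v hv huv
    have hu := (h.mem u (by simpa using hu)).1
    have hv := (h.mem v (by simpa using hv)).1
    have := (ZMod.natCast_eq_natCast_iff' u v p).1 huv
    rwa [Nat.mod_eq_of_lt hu, Nat.mod_eq_of_lt hv] at this
  rw [← List.toFinset_card_of_nodup h.nodup]
  exact Finset.card_le_card_of_injOn _ (fun u hu => (h.mem u (by simpa using hu)).2) hinj

theorem exists_notMem [NeZero p] (hlt : U.length < S.card) :
    ∃ w < p, (w : ZMod p) ∈ S ∧ w ∉ U := by
  by_contra! hcon
  have : S ⊆ U.toFinset.image fun u : ℕ => (u : ZMod p) := by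
    intro x hx
    refine Finset.mem_image.2 ⟨x.val, ?_, ZMod.natCast_zmod_val x⟩
    exact List.mem_toFinset.2 (hcon _ x.val_lt (by rwa [ZMod.natCast_zmod_val]))
  have := (Finset.card_le_card this).trans (Finset.card_image_le.trans U.toFinset_card_le)
  omega

/-- The invariant `M ≤ |T| + r` makes an early exit meaningful: a new sum at `r = 0` gives more than
`M` distinct elements of `A + A`. Otherwise the continuation ran and succeeded. -/
theorem exists_of_addSums [NeZero p] {A : Finset (ZMod p)} {M w : ℕ} (hw : (w : ZMod p) ∈ A)
    {k : List ℕ → ℕ → Bool} : ∀ {U T : List ℕ} {r : ℕ}, (∀ u ∈ U, (u : ZMod p) ∈ A) →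
      ListsResidues (A + A) T → M ≤ T.length + r → addSums p w U T r k = true →
      M < (A + A).card ∨ ∃ T' r', ListsResidues (A + A) T' ∧ M ≤ T'.length + r' ∧ k T' r' = true
  | [], T, r, _, hT, hr, hk => Or.inr ⟨T, r, hT, hr, hk⟩
  | u :: U, T, r, hU, hT, hr, hk => by
    have hU' : ∀ v ∈ U, (v : ZMod p) ∈ A := fun v hv => hU v (List.mem_cons_of_mem _ hv)
    rw [addSums.eq_def] at hk
    simp only [forceNat_eq] at hk
    by_cases hmem : memNat (Nat.mod (Nat.add w u) p) T = true
    · rw [hmem] at hk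
      exact exists_of_addSums hw hU' hT hr hk
    · rw [Bool.eq_false_iff.2 hmem] at hk
      rw [memNat_eq_true] at hmem
      have hT' := hT.cons (Nat.mod_lt _ (NeZero.pos p)) (by
        change (((w + u) % p : ℕ) : ZMod p) ∈ A + A
        rw [ZMod.natCast_mod, Nat.cast_add]
        exact Finset.add_mem_add hw (hU u List.mem_cons_self)) hmem
      cases r with
      | zero =>
        have := hT'.length_le
        rw [List.length_cons] at this
        exact Or.inl (by omega)
      | succ r => exact exists_of_addSums hw hU' hT' (by rw [List.length_cons]; omega) hk

end ListsResidues

/-- `U` lists elements of `A`, and `T` lists elements of `A + A`, at least `M - r` of them. -/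
structure IsPartialSumset {p : ℕ} (A : Finset (ZMod p)) (M : ℕ) (U T : List ℕ) (r : ℕ) :
    Prop where
  set : ListsResidues A U
  sum : ListsResidues (A + A) T
  le : M ≤ T.length + r

namespace IsPartialSumset

variable {p M : ℕ} {A : Finset (ZMod p)}

theorem exists_of_adjoin [NeZero p] {U T : List ℕ} {r : ℕ} (h : IsPartialSumset A M U T r)
    {w : ℕ} (hwp : w < p) (hw : (w : ZMod p) ∈ A) {k : List ℕ → List ℕ → ℕ → Bool}
    (hk : adjoin p w U T r k = true) : M < (A + A).card ∨
      ∃ U' T' r', IsPartialSumset A M U' T' r' ∧ U'.length ≤ U.length + 1 ∧ k U' T' r' = true := by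
  rw [adjoin] at hk
  by_cases hmem : memNat w U = true
  · rw [hmem] at hk
    exact Or.inr ⟨U, T, r, h, Nat.le_succ _, hk⟩
  · rw [Bool.eq_false_iff.2 hmem] at hk
    rw [memNat_eq_true] at hmem
    have hU := h.set.cons hwp hw hmem
    refine (ListsResidues.exists_of_addSums hw (fun u hu => (hU.mem u hu).2)
      h.sum h.le hk).imp_right ?_
    rintro ⟨T', r', hT', hr', hk'⟩
    exact ⟨w :: U, T', r', ⟨hU, hT', hr'⟩, le_rfl, hk'⟩

variable {L : List ℕ}

theorem lt_card_of_extendSearch [NeZero p] (hL : ∀ w < p, (w : ZMod p) ∈ A → w ∈ L) :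
    ∀ (k : ℕ) {U T : List ℕ} {r : ℕ}, IsPartialSumset A M U T r → U.length + k ≤ A.card →
      extendSearch p L k U T r = true → M < (A + A).card
  | 0, _, _, _, _, _, hs => absurd hs (by simp [extendSearch])
  | k + 1, U, T, r, h, hk, hs => by
    rw [extendSearch, List.all_eq_true] at hs
    -- The search succeeds for every `w` in `L`, so any unlisted element of `A` will do.
    obtain ⟨w, hwp, hw, hwU⟩ := ListsResidues.exists_notMem (S := A) (U := U) (by omega)
    have := hs w (hL w hwp hw)
    rw [Bool.or_eq_true, memNat_eq_true] at this
    rcases h.exists_of_adjoin hwp hw (this.resolve_left hwU) with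
      hlt | ⟨U', T', r', h', hlen, hs'⟩
    · exact hlt
    · exact lt_card_of_extendSearch hL k h' (by omega) hs'

theorem lt_card_of_pairSearch [NeZero p] (hL : ∀ w < p, (w : ZMod p) ∈ A → w ∈ L)
    (hA : A.card = 6) :
    ∀ (n : ℕ) {P U T : List ℕ} {r : ℕ}, IsPartialSumset A M U T r →
      (∃ l : List ℕ, l.Sublist P ∧ l.length = n ∧
        ∀ x ∈ l, x < p ∧ (x : ZMod p) ∈ A ∧ (x : ZMod p) + 1 ∈ A) →
      pairSearch p L n P U T r = true → M < (A + A).card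
  | 0, P, U, T, r, h, _, hs => by
    have := h.set.length_le
    rw [pairSearch.eq_def] at hs
    exact lt_card_of_extendSearch hL _ h (by omega) hs
  | n + 1, [], U, T, r, h, ⟨l, hl, hlen, _⟩, hs => by
    rw [List.sublist_nil.1 hl] at hlen
    simp at hlen
  | n + 1, x :: P, U, T, r, h, ⟨l, hl, hlen, hlA⟩, hs => by
    rw [pairSearch, Bool.and_eq_true] at hs
    rcases List.sublist_cons_iff.1 hl with hl' | ⟨l, rfl, hl'⟩
    · exact lt_card_of_pairSearch hL hA (n + 1) h ⟨l, hl', hlen, hlA⟩ hs.2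
    · obtain ⟨hxp, hx, hx1⟩ := hlA x List.mem_cons_self
      rcases h.exists_of_adjoin hxp hx hs.1 with hlt | ⟨U, T, r, h, -, hs⟩
      · exact hlt
      rw [forceNat_eq] at hs
      have hx1' : (((x + 1) % p : ℕ) : ZMod p) ∈ A := by rwa [ZMod.natCast_mod, Nat.cast_succ]
      rcases h.exists_of_adjoin (Nat.mod_lt _ (NeZero.pos p)) hx1' hs with
        hlt | ⟨U, T, r, h, -, hs⟩
      · exact hlt
      · exact lt_card_of_pairSearch hL hA n h
          ⟨l, hl', by simpa using hlen, fun y hy => hlA y (List.mem_cons_of_mem _ hy)⟩ hs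

end IsPartialSumset

theorem isSquareMod_iff {p : ℕ} [NeZero p] (x : ZMod p) :
    isSquareMod p x.val = true ↔ IsSquare x := by
  simp only [isSquareMod, List.any_eq_true, List.mem_range, Nat.beq_eq]
  constructor
  · rintro ⟨i, -, hi⟩
    refine ⟨i, ?_⟩
    rw [← ZMod.natCast_zmod_val x, ← hi, ZMod.natCast_mod, Nat.cast_mul]
  · rintro ⟨r, rfl⟩
    exact ⟨r.val, r.val_lt, (ZMod.val_mul r r).symm⟩

/-- The search applies to sets normalised to have three pairs with difference one. -/
theorem lt_card_add_self_of_normalized {p : ℕ} [NeZero p] {M : ℕ}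
    (h : noSmallSumset p M = true) {A : Finset (ZMod p)} (hA : A.card = 6) (c : Bool)
    (hc : ∀ x ∈ A, x = 0 ∨ (IsSquare x ↔ c = true))
    (h3 : 3 ≤ (A.filter fun x => x + 1 ∈ A).card) : M < (A + A).card := by
  rw [noSmallSumset, List.all_eq_true] at h
  have hs := h c (by cases c <;> simp)
  rw [forceList_eq, forceList_eq] at hs
  set L := (List.range p).filter fun w => Nat.beq w 0 || (isSquareMod p w == c) with hLdef
  have hL : ∀ w < p, (w : ZMod p) ∈ A → w ∈ L := by
    intro w hwp hw
    have hval : (w : ZMod p).val = w := ZMod.val_cast_of_lt hwp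
    refine List.mem_filter.2 ⟨List.mem_range.2 hwp, ?_⟩
    rw [Bool.or_eq_true, Nat.beq_eq, beq_iff_eq]
    refine (hc w hw).imp (fun h0 => ?_) fun hiff => ?_
    · rw [← hval, h0, ZMod.val_zero]
    · rw [← isSquareMod_iff, hval] at hiff
      exact Bool.eq_iff_iff.2 hiff
  refine IsPartialSumset.lt_card_of_pairSearch hL hA 3 (U := []) (T := [])
    ⟨⟨by simp, List.nodup_nil⟩, ⟨by simp, List.nodup_nil⟩, Nat.le_add_left M _⟩ ?_ hs
  set l := (List.range p).filter fun i : ℕ =>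
    decide ((i : ZMod p) ∈ A ∧ (i : ZMod p) + 1 ∈ A) with hl
  have hlmem : ∀ x, x ∈ l ↔ x < p ∧ (x : ZMod p) ∈ A ∧ (x : ZMod p) + 1 ∈ A := by
    intro x; simp [hl, List.mem_filter]
  have hlen : 3 ≤ l.length := by
    have hsub : (A.filter fun x => x + 1 ∈ A) ⊆ l.toFinset.image fun i : ℕ => (i : ZMod p) := by
      intro x hx
      have hx := Finset.mem_filter.1 hx
      refine Finset.mem_image.2 ⟨x.val, ?_, ZMod.natCast_zmod_val x⟩
      rw [List.mem_toFinset, hlmem, ZMod.natCast_zmod_val]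
      exact ⟨x.val_lt, hx⟩
    exact h3.trans ((Finset.card_le_card hsub).trans
      (Finset.card_image_le.trans l.toFinset_card_le))
  refine ⟨l.take 3, (List.take_sublist 3 l).trans ?_, by simp [hlen],
    fun x hx => (hlmem x).1 (List.mem_of_mem_take hx)⟩
  -- As a filter of the candidate list, `l` keeps its order and is a sublist of it, as `pairSearch`
  -- requires.
  have hfl : l = (L.filter fun w => memNat ((w + 1) % p) L).filter fun i : ℕ =>
      decide ((i : ZMod p) ∈ A ∧ (i : ZMod p) + 1 ∈ A) := by
    rw [hLdef, List.filter_filter, List.filter_filter, hl]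
    refine List.filter_congr fun i hi => ?_
    rw [List.mem_range] at hi
    rw [Bool.eq_iff_iff, Bool.and_eq_true, Bool.and_eq_true, ← hLdef, memNat_eq_true]
    refine ⟨fun hiA => ⟨⟨hiA, ?_⟩, ?_⟩, fun h => h.1.1⟩
    · rw [decide_eq_true_eq] at hiA
      exact hL _ (Nat.mod_lt _ (NeZero.pos p)) (by rw [ZMod.natCast_mod, Nat.cast_succ]; exact hiA.2)
    · rw [decide_eq_true_eq] at hiA
      exact (List.mem_filter.1 (hL i hi hiA.1)).2
  rw [hfl]
  exact List.filter_sublist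

/-- Dilation by `d⁻¹` turns the popular difference into 1 and sends nonzero squares into the
quadratic class of `d`, which is the choice of `c`. -/
theorem lt_card_add_self {p : ℕ} [Fact p.Prime] {M : ℕ} (hM : M ≤ 13)
    (h : noSmallSumset p M = true) {A : Finset (ZMod p)} (hA : A.card = 6)
    (hsq : (A : Set (ZMod p)) ⊆ squares (ZMod p)) : M < (A + A).card := by
  by_contra! hcon
  obtain ⟨d, hd, h3⟩ := exists_three_le_card_filter_add_mem hA (hcon.trans hM)
  have hinj : Function.Injective fun x : ZMod p => d⁻¹ * x := mul_right_injective₀ (inv_ne_zero hd)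
  have hB : (A.image fun x => d⁻¹ * x).card = 6 := by rw [Finset.card_image_of_injective _ hinj, hA]
  have hadd : (A.image fun x => d⁻¹ * x) + (A.image fun x => d⁻¹ * x) =
      (A + A).image fun x => d⁻¹ * x :=
    (Finset.image_add (AddMonoidHom.mulLeft d⁻¹)).symm
  refine absurd (lt_card_add_self_of_normalized h hB (decide (IsSquare d)) ?_ ?_) ?_
  · intro x hx
    obtain ⟨a, ha, rfl⟩ := Finset.mem_image.1 hx
    obtain ⟨r, rfl⟩ := hsq (Finset.mem_coe.2 ha)
    rw [decide_eq_true_eq]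
    by_cases hr : r = 0
    · left; simp [hr]
    right
    constructor
    · rintro ⟨s, hs⟩
      have hs0 : s ≠ 0 := by
        rintro rfl
        simp [hd, hr] at hs
      refine ⟨r / s, ?_⟩
      field_simp at hs ⊢
      linear_combination -hs
    · rintro ⟨s, rfl⟩
      refine ⟨r / s, ?_⟩
      have hs0 : s ≠ 0 := by rintro rfl; simp at hd
      field_simp
  · refine h3.trans ?_
    rw [← Finset.card_image_of_injective _ hinj]
    refine Finset.card_le_card fun x hx => ?_
    obtain ⟨a, ha, rfl⟩ := Finset.mem_image.1 hx
    have ha := Finset.mem_filter.1 ha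
    refine Finset.mem_filter.2 ⟨Finset.mem_image_of_mem _ ha.1, ?_⟩
    refine Finset.mem_image.2 ⟨a + d, ha.2, ?_⟩
    rw [mul_add, inv_mul_cancel₀ hd]
  · rw [hadd, Finset.card_image_of_injective _ hinj]
    exact not_lt.2 hcon

/-- The value of `minSumset 6` from a search and a witness. -/
theorem minSumset_six_eq {p : ℕ} (hp : p.Prime) {M : ℕ} (hM : M ≤ 13)
    (h : noSmallSumset p M = true) (B : Finset (ZMod p))
    (hB : (B.image (· ^ 2)).card = 6 ∧ (B.image (· ^ 2) + B.image (· ^ 2)).card ≤ M + 1) :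
    minSumset 6 (ZMod p) = (M + 1 : ℕ) :=
  have : Fact p.Prime := ⟨hp⟩
  le_antisymm (minSumset_le_of_roots B hB)
    (le_minSumset fun _ hsq hA => lt_card_add_self hM h hA hsq)

theorem minSumset_six_eq_eleven {p : ℕ} (hp : p.Prime) (h : 11 ≤ p) (B : Finset (ZMod p))
    (hB : (B.image (· ^ 2)).card = 6 ∧ (B.image (· ^ 2) + B.image (· ^ 2)).card ≤ 11) :
    minSumset 6 (ZMod p) = 11 :=
  le_antisymm (minSumset_le_of_roots B hB) (eleven_le_minSumset_six hp h)

/-! ### Colourings by the quadratic character -/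

/-- `x` is zero or has quadratic character `s`. -/
def HasColor {F : Type*} [Field F] [Fintype F] [DecidableEq F] (s : ℤ) (x : F) : Prop :=
  x = 0 ∨ quadraticChar F x = s

/-- A decision tree on the colours of integers; the leaves name progressions `a, …, a + 5 d`. -/
inductive ColorTree
  | leaf (a : ℤ) (d : ℤ)
  | split (q : ℤ) (l r : ColorTree)

/-- The colour of `n` if it is a product of at most `fuel` integers of known colour. -/
def colorOf (env : List (ℤ × ℤ)) : (fuel : ℕ) → ℤ → Option ℤ
  | 0, _ => none
  | k + 1, n =>
    if n = 1 then some 1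
    -- Since `-1` divides everything, it is split off only from negative numbers; otherwise the sign
    -- could flip until the fuel ran out.
    else match env.find? fun e => e.1 * (n / e.1) = n ∧ (e.1 = -1 → n < 0) with
      | none => none
      | some e => (colorOf env k (n / e.1)).map (e.2 * ·)

/-- Each leaf reached names a progression of one colour whose difference is below `D`. -/
def ColorTree.check (D : ℤ) : ColorTree → List (ℤ × ℤ) → Bool
  | leaf a d, env => (0 < d && d < D : Bool) && [1, -1].any fun s =>
      (List.range 6).all fun i =>
        (a + (i : ℕ) * d = 0 : Bool) || (colorOf env 16 (a + (i : ℕ) * d) = some s : Bool)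
  | split q l r, env => l.check D ((q, 1) :: env) && r.check D ((q, -1) :: env)

section HasColor

variable {F : Type*} [Field F] [Fintype F] [DecidableEq F]

/-- Zero carries every colour, so no nonvanishing assumption is needed. -/
theorem HasColor.mul {s t : ℤ} {x y : F} (hx : HasColor s x) (hy : HasColor t y) :
    HasColor (s * t) (x * y) := by
  rcases hx with rfl | hx
  · left; simp
  rcases hy with rfl | hy
  · left; simp
  right; rw [map_mul, hx, hy]

theorem hasColor_or (x : F) : HasColor 1 x ∨ HasColor (-1) x := by
  by_cases hx : x = 0
  · exact Or.inl (Or.inl hx)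
  · exact (quadraticChar_dichotomy hx).imp Or.inr Or.inr

theorem HasColor.isSquare {x : F} (h : HasColor 1 x) : IsSquare x := by
  rcases h with rfl | h
  · exact IsSquare.zero
  · by_cases hx : x = 0
    · rw [hx]; exact IsSquare.zero
    · exact (quadraticChar_one_iff_isSquare hx).1 h

theorem hasColor_one_sq (x : F) : HasColor 1 (x ^ 2) := by
  by_cases hx : x = 0
  · left; simp [hx]
  · exact Or.inr (quadraticChar_sq_one' hx)

theorem hasColor_of_colorOf {env : List (ℤ × ℤ)} (henv : ∀ e ∈ env, HasColor e.2 (e.1 : F)) :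
    ∀ (k : ℕ) {n s : ℤ}, colorOf env k n = some s → HasColor s (n : F)
  | 0, _, _, h => by simp [colorOf] at h
  | k + 1, n, s, h => by
    rw [colorOf] at h
    split_ifs at h with hn
    · obtain rfl := Option.some.inj h
      right; simp [hn]
    · split at h
      · simp at h
      · rename_i e he
        obtain ⟨t, ht, rfl⟩ := Option.map_eq_some_iff.1 h
        have hmul : e.1 * (n / e.1) = n ∧ (e.1 = -1 → n < 0) := by
          simpa only [decide_eq_true_eq] using List.find?_some he
        have := (henv e (List.mem_of_find?_eq_some he)).mul (hasColor_of_colorOf henv k ht)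
        rwa [← Int.cast_mul, hmul.1] at this

theorem ColorTree.exists_progression {D : ℤ} (t : ColorTree) {env : List (ℤ × ℤ)}
    (henv : ∀ e ∈ env, HasColor e.2 (e.1 : F)) (h : t.check D env = true) :
    ∃ a d s : ℤ, 0 < d ∧ d < D ∧ (s = 1 ∨ s = -1) ∧
      ∀ i < 6, HasColor s ((a + (i : ℕ) * d : ℤ) : F) := by
  induction t generalizing env with
  | leaf a d =>
    simp only [ColorTree.check, Bool.and_eq_true, decide_eq_true_eq, List.any_eq_true,
      List.all_eq_true, Bool.or_eq_true, List.mem_range] at h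
    obtain ⟨⟨h1, h2⟩, s, hs, h3⟩ := h
    refine ⟨a, d, s, h1, h2, by simpa using hs, fun i hi => ?_⟩
    rcases h3 i hi with h0 | h0
    · left; rw [h0]; simp
    · exact hasColor_of_colorOf henv 16 h0
  | split q l r ihl ihr =>
    simp only [ColorTree.check, Bool.and_eq_true] at h
    rcases hasColor_or (q : F) with hq | hq
    · exact ihl (by simpa [hq] using henv) h.1
    · exact ihr (by simpa [hq] using henv) h.2

end HasColor

/-- Multiplying the progression of colour `s` by an element `g` of character `s` makes its terms
squares; `0 < d < p` keeps the difference nonzero. -/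
theorem ColorTree.minSumset_six_le {p : ℕ} [Fact p.Prime] (hp : 6 ≤ p) (t : ColorTree) (S : List ℤ)
    (h : t.check p (S.map fun q => (q ^ 2, 1)) = true) : minSumset 6 (ZMod p) ≤ 11 := by
  obtain ⟨a, d, s, h0, hd, hs, hc⟩ := t.exists_progression (F := ZMod p) (by
    intro e he
    obtain ⟨q, -, rfl⟩ := List.mem_map.1 he
    simpa using hasColor_one_sq (q : ZMod p)) h
  have hd' : (d : ZMod p) ≠ 0 := by
    rw [Ne, ZMod.intCast_zmod_eq_zero_iff_dvd]
    exact fun hdvd => absurd (Int.le_of_dvd h0 hdvd) (by omega)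
  obtain ⟨g, hg0, hg⟩ : ∃ g : ZMod p, g ≠ 0 ∧ HasColor s g := by
    rcases hs with rfl | rfl
    · exact ⟨1, one_ne_zero, Or.inr (by simp)⟩
    · obtain ⟨g, hg⟩ := quadraticChar_exists_neg_one' (F := ZMod p)
        (by rw [ZMod.ringChar_zmod_n]; omega)
      exact ⟨g, g.ne_zero, Or.inr hg⟩
  refine minSumset_six_le_of_progression hp (a := g * a) (mul_ne_zero hg0 hd') fun i hi => ?_
  have := hg.mul (hc i hi)
  rw [show s * s = 1 by rcases hs with rfl | rfl <;> norm_num] at this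
  convert this.isSquare using 1
  push_cast; ring

theorem ColorTree.check_mono {D E : ℤ} (hDE : D ≤ E) (t : ColorTree) {env : List (ℤ × ℤ)}
    (h : t.check D env = true) : t.check E env = true := by
  induction t generalizing env with
  | leaf a d =>
    simp only [ColorTree.check, Bool.and_eq_true, decide_eq_true_eq] at h ⊢
    exact ⟨⟨h.1.1, h.1.2.trans_le hDE⟩, h.2⟩
  | split q l r ihl ihr =>
    simp only [ColorTree.check, Bool.and_eq_true] at h ⊢
    exact ⟨ihl h.1, ihr h.2⟩

/-- A tree that shows that six terms of one colour in progression always exist. -/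
def progressionTree : ColorTree :=
  .split 3 (.split 2 (.split 5 (.leaf 1 1) (.split (-1) (.leaf (-4) 1) (.split 7 (.split 11
    (.split 13 (.leaf 1 5) (.split 17 (.leaf 7 5) (.split 29 (.leaf (-55) 21) (.leaf (-91)
    31)))) (.split 29 (.leaf (-55) 13) (.split 13 (.split 17 (.leaf (-50) 11) (.leaf (-17) 6))
    (.split 17 (.leaf (-175) 47) (.leaf (-91) 23))))) (.split 17 (.leaf (-25) 8) (.split 41
    (.leaf (-64) 23) (.split 73 (.leaf 4 23) (.split 11 (.split 13 (.leaf 4 7) (.split 29 (.leaf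
    (-55) 21) (.leaf (-29) 8))) (.split 13 (.leaf (-91) 23) (.leaf 5 17))))))))) (.split 5
    (.split (-1) (.leaf (-5) 2) (.split 19 (.split 7 (.split 11 (.leaf 1 2) (.split 13 (.leaf 13
    3) (.split 17 (.split 23 (.leaf 17 2) (.leaf (-243) 59)) (.leaf (-34) 9)))) (.split 13
    (.split 17 (.leaf 12 1) (.leaf (-28) 11)) (.leaf (-35) 11))) (.leaf 5 11))) (.split 7
    (.split (-1) (.split 13 (.leaf 1 3) (.split 23 (.leaf (-49) 13) (.split 29 (.leaf 25 1)
    (.split 17 (.leaf (-116) 31) (.split 11 (.leaf (-165) 37) (.leaf 8 3)))))) (.leaf (-10) 3))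
    (.split (-1) (.leaf (-40) 13) (.split 11 (.split 19 (.leaf (-35) 8) (.leaf (-36) 11)) (.leaf
    (-11) 3)))))) (.split 2 (.split 5 (.split (-1) (.split 7 (.leaf (-10) 3) (.split 11 (.leaf
    (-11) 3) (.split 67 (.leaf (-84) 17) (.split 13 (.split 17 (.leaf 5 4) (.split 43 (.leaf
    (-43) 17) (.leaf (-258) 89))) (.split 29 (.leaf (-77) 19) (.leaf (-203) 41)))))) (.split 11
    (.leaf (-32) 7) (.split 7 (.split 13 (.leaf 1 3) (.leaf (-80) 31)) (.leaf (-15) 4))))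
    (.split (-1) (.split 19 (.leaf (-49) 17) (.split 107 (.leaf 100 7) (.split 7 (.split 11
    (.split 13 (.split 17 (.leaf 13 1) (.split 31 (.leaf (-361) 113) (.leaf 10 7))) (.leaf 5 7))
    (.leaf (-35) 8)) (.split 11 (.split 17 (.leaf (-35) 13) (.leaf (-107) 31)) (.leaf (-50)
    17))))) (.split 11 (.leaf (-32) 7) (.split 13 (.split 19 (.split 7 (.leaf (-25) 6) (.split
    17 (.leaf (-33) 8) (.leaf (-114) 23))) (.leaf (-19) 7)) (.leaf (-27) 7))))) (.split 7
    (.split 5 (.split (-1) (.split 11 (.leaf (-16) 5) (.split 13 (.split 17 (.leaf (-33) 8)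
    (.leaf (-80) 29)) (.leaf 10 1))) (.split 37 (.split 11 (.split 13 (.split 17 (.leaf (-17) 4)
    (.split 23 (.leaf 16 7) (.split 79 (.leaf (-395) 139) (.leaf (-102) 23)))) (.leaf (-63) 19))
    (.split 13 (.leaf (-49) 12) (.leaf 10 1))) (.leaf (-75) 19))) (.split (-1) (.split 11 (.leaf
    (-16) 5) (.split 17 (.leaf (-33) 8) (.leaf 5 3))) (.leaf (-10) 3))) (.split (-1) (.split 11
    (.leaf (-21) 5) (.split 13 (.split 17 (.split 5 (.leaf 5 4) (.split 31 (.leaf 4 9) (.leaf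
    (-50) 19))) (.leaf (-17) 5)) (.leaf (-18) 5))) (.split 5 (.split 11 (.split 13 (.leaf (-13)
    4) (.leaf 1 5)) (.leaf (-15) 4)) (.split 11 (.split 13 (.split 97 (.leaf (-140) 43) (.leaf
    (-384) 95)) (.leaf 1 5)) (.leaf (-11) 3))))))

/-- The squares of 7, 11 and 17 have colour 1 even on branches that do not decide these primes. The
largest difference in the tree is 139. -/
theorem progressionTree_check :
    progressionTree.check 149 ([7, 11, 17].map fun q => (q ^ 2, 1)) = true := by decide +kernel

theorem minSumset_six_of_le {p : ℕ} (hp : p.Prime) (h : 149 ≤ p) :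
    minSumset 6 (ZMod p) = 11 := by
  have : Fact p.Prime := ⟨hp⟩
  exact le_antisymm (progressionTree.minSumset_six_le (by omega) [7, 11, 17]
    (progressionTree.check_mono (by exact_mod_cast h) progressionTree_check))
    (eleven_le_minSumset_six hp (by omega))

/-! ### Small primes -/

theorem noSmallSumset_17 : noSmallSumset 17 11 = true := by decide +kernel

theorem noSmallSumset_23 : noSmallSumset 23 11 = true := by decide +kernel

theorem noSmallSumset_41 : noSmallSumset 41 11 = true := by decide +kernel

theorem noSmallSumset_43 : noSmallSumset 43 11 = true := by decide +kernel

theorem noSmallSumset_47 : noSmallSumset 47 11 = true := by decide +kernel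

set_option maxHeartbeats 4000000 in
theorem noSmallSumset_113 : noSmallSumset 113 11 = true := by decide +kernel

set_option maxHeartbeats 4000000 in
theorem noSmallSumset_139 : noSmallSumset 139 11 = true := by decide +kernel

theorem noSmallSumset_13 : noSmallSumset 13 12 = true := by decide +kernel

theorem noSmallSumset_19 : noSmallSumset 19 12 = true := by decide +kernel

theorem noSmallSumset_31 : noSmallSumset 31 12 = true := by decide +kernel

theorem noSmallSumset_37 : noSmallSumset 37 12 = true := by decide +kernel

set_option maxHeartbeats 4000000 in
theorem noSmallSumset_59 : noSmallSumset 59 12 = true := by decide +kernel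

theorem noSmallSumset_29 : noSmallSumset 29 13 = true := by decide +kernel

/-- For `p = 11` the witness is the set of all six squares. For the other primes Vosper's theorem
forces a progression, so each list consists of square roots of six squares in progression. -/
theorem minSumset_six_eleven {p : ℕ} (hp : p.Prime)
    (h : p ∈ ({11, 53, 61, 67, 71, 73, 79, 83, 89, 97, 101, 103, 107, 109,
      127, 131, 137} : Set ℕ)) :
    minSumset 6 (ZMod p) = 11 := by
  simp only [Set.mem_insert_iff, Set.mem_singleton_iff] at h
  rcases h with rfl | rfl | rfl | rfl | rfl | rfl | rfl | rfl | rfl | rfl | rfl | rfl | rfl |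
    rfl | rfl | rfl | rfl
  · exact minSumset_six_eq_eleven hp (by norm_num) {0, 1, 2, 3, 4, 5} (by decide +kernel)
  · exact minSumset_six_eq_eleven hp (by norm_num) {3, 8, 11, 15, 21, 22} (by decide +kernel)
  · exact minSumset_six_eq_eleven hp (by norm_num) {1, 8, 11, 19, 26, 27} (by decide +kernel)
  · exact minSumset_six_eq_eleven hp (by norm_num) {5, 15, 17, 19, 25, 31} (by decide +kernel)
  · exact minSumset_six_eq_eleven hp (by norm_num) {0, 1, 2, 12, 17, 28} (by decide +kernel)
  · exact minSumset_six_eq_eleven hp (by norm_num) {0, 1, 12, 17, 19, 27} (by decide +kernel)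
  · exact minSumset_six_eq_eleven hp (by norm_num) {10, 16, 24, 27, 38, 39} (by decide +kernel)
  · exact minSumset_six_eq_eleven hp (by norm_num) {5, 14, 19, 21, 32, 39} (by decide +kernel)
  · exact minSumset_six_eq_eleven hp (by norm_num) {1, 2, 9, 16, 23, 40} (by decide +kernel)
  · exact minSumset_six_eq_eleven hp (by norm_num) {0, 1, 17, 22, 26, 44} (by decide +kernel)
  · exact minSumset_six_eq_eleven hp (by norm_num) {11, 15, 18, 23, 25, 27} (by decide +kernel)
  · exact minSumset_six_eq_eleven hp (by norm_num) {4, 11, 18, 23, 29, 42} (by decide +kernel)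
  · exact minSumset_six_eq_eleven hp (by norm_num) {3, 11, 15, 21, 36, 44} (by decide +kernel)
  · exact minSumset_six_eq_eleven hp (by norm_num) {1, 10, 18, 33, 39, 50} (by decide +kernel)
  · exact minSumset_six_eq_eleven hp (by norm_num) {14, 18, 24, 31, 33, 43} (by decide +kernel)
  · exact minSumset_six_eq_eleven hp (by norm_num) {18, 37, 42, 45, 53, 60} (by decide +kernel)
  · exact minSumset_six_eq_eleven hp (by norm_num) {4, 17, 29, 39, 44, 47} (by decide +kernel)

theorem minSumset_six_twelve {p : ℕ} (hp : p.Prime)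
    (h : p ∈ ({17, 23, 41, 43, 47, 113, 139} : Set ℕ)) :
    minSumset 6 (ZMod p) = 12 := by
  simp only [Set.mem_insert_iff, Set.mem_singleton_iff] at h
  rcases h with rfl | rfl | rfl | rfl | rfl | rfl | rfl
  · exact minSumset_six_eq hp (by norm_num) noSmallSumset_17 {0, 1, 3, 4, 5, 6}
      (by decide +kernel)
  · exact minSumset_six_eq hp (by norm_num) noSmallSumset_23 {0, 1, 2, 5, 7, 11}
      (by decide +kernel)
  · exact minSumset_six_eq hp (by norm_num) noSmallSumset_41 {0, 1, 9, 12, 15, 17}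
      (by decide +kernel)
  · exact minSumset_six_eq hp (by norm_num) noSmallSumset_43 {3, 5, 9, 14, 15, 18}
      (by decide +kernel)
  · exact minSumset_six_eq hp (by norm_num) noSmallSumset_47 {0, 1, 2, 7, 10, 12}
      (by decide +kernel)
  · exact minSumset_six_eq hp (by norm_num) noSmallSumset_113 {0, 1, 13, 15, 31, 51}
      (by decide +kernel)
  · exact minSumset_six_eq hp (by norm_num) noSmallSumset_139 {5, 16, 21, 33, 37, 40}
      (by decide +kernel)

theorem minSumset_six_thirteen {p : ℕ} (hp : p.Prime)
    (h : p ∈ ({13, 19, 31, 37, 59} : Set ℕ)) :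
    minSumset 6 (ZMod p) = 13 := by
  simp only [Set.mem_insert_iff, Set.mem_singleton_iff] at h
  rcases h with rfl | rfl | rfl | rfl | rfl
  · exact minSumset_six_eq hp (by norm_num) noSmallSumset_13 {0, 1, 2, 3, 4, 6}
      (by decide +kernel)
  · exact minSumset_six_eq hp (by norm_num) noSmallSumset_19 {2, 3, 5, 7, 8, 9}
      (by decide +kernel)
  · exact minSumset_six_eq hp (by norm_num) noSmallSumset_31 {2, 3, 6, 10, 14, 15}
      (by decide +kernel)
  · exact minSumset_six_eq hp (by norm_num) noSmallSumset_37 {3, 7, 8, 11, 14, 18}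
      (by decide +kernel)
  · exact minSumset_six_eq hp (by norm_num) noSmallSumset_59 {2, 7, 8, 14, 15, 16}
      (by decide +kernel)

theorem minSumset_six_fourteen : minSumset 6 (ZMod 29) = 14 := by
  exact minSumset_six_eq (by norm_num) (by norm_num) noSmallSumset_29 {0, 1, 2, 6, 8, 11}
      (by decide +kernel)

theorem mainTheorem8 (p : ℕ) (hp : p.Prime) :
    ((p ∈ ({11, 53, 61, 67, 71, 73, 79, 83, 89, 97, 101, 103, 107, 109, 127, 131, 137} : Set ℕ) ∨
        149 ≤ p) → minSumset 6 (ZMod p) = 11) ∧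
    (p ∈ ({17, 23, 41, 43, 47, 113, 139} : Set ℕ) → minSumset 6 (ZMod p) = 12) ∧
    (p ∈ ({13, 19, 31, 37, 59} : Set ℕ) → minSumset 6 (ZMod p) = 13) ∧
    (p = 29 → minSumset 6 (ZMod p) = 14) := by
  refine ⟨fun h => h.elim (minSumset_six_eleven hp) (minSumset_six_of_le hp),
    minSumset_six_twelve hp, minSumset_six_thirteen hp, ?_⟩
  rintro rfl
  exact minSumset_six_fourteen
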